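/- Let $n\ge 1$, and let $A\in M_n(\mathbb{Z})$ be an invertible matrix ($\det A\neq 0$) such that $x\mapsto A^{-1}x$ is a similarity of $\mathbb{R}^n$ for the Euclidean distance, with contraction coefficient in $(0,1)$. For a finite set $S\subset\mathbb{Z}^n$, an $(A,S)$-representation of $x\in\mathbb{R}^n$ is a sequence $(d_j)_{j\ge1}$ in $S$ with $x=\sum_{j\ge1}A^{-j}d_j$, and $T_{A,S}$ is the set of all points that have an $(A,S)$-representation. Let $\mathcal{D}\subset\mathbb{Z}^n$ be a complete residue system mod $A$, that is, the canonical map $\mathcal{D}\to\mathbb{Z}^n/A\mathbb{Z}^n$ is bijective. Suppose that $T_{A,\mathcal{D}}$ is a self-affine tile: it is the closure of its interior, and $(T_{A,\mathcal{D}}+d)\cap(T_{A,\mathcal{D}}+d')$ has Lebesgue measure zero for all distinct $d,d'\in\mathcal{D}$. Let $D\subset\mathcal{D}$ be such that every point of $\mathbb{R}^n$ has at most one $(A,D-D)$-representation. Put $T(\alpha)=T_{A,D}\cap(T_{A,D}+\alpha)$ and $F_{A,D}=\{\alpha\in\mathbb{R}^n : T(\alpha)\neq\emptyset\}$. Then for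 every $s\in[0,\dim_H T_{A,D}]$ the level set $\{\alpha\in F_{A,D} : \dim_H T(\alpha)=s\}$ is dense in $F_{A,D}$. Moreover, for every $\alpha\in F_{A,D}$, the set $T(\alpha)$ is a Moran set and $\dim_H T(\alpha)=\underline{\dim}_B T(\alpha)$. Here $\underline{\dim}_B X=\liminf_{\delta\downarrow0}\log N_\delta(X)/(-\log\delta)$, where $N_\delta(X)$ is the smallest number of sets of diameter at most $\delta$ that cover $X$. A Moran set is a set of the form $E=\bigcap_{k\ge1}\bigcup_{\sigma\in W_k}J_\sigma$ obtained as follows. There are positive integers $n_k$ ($k\ge1$) and numbers $c_{k,j}\in(0,1)$ ($1\le j\le n_k$); $W_k$ is the set of words $(j_1,\dots,j_k)$ with $1\le j_\ell\le n_\ell$, and $W_0$ consists of the empty word. The set $J_\emptyset\subset\mathbb{R}^n$ is compact with nonempty interior; each $J_\sigma$ with $\sigma\in W_k$, $k\ge1$, is the image of $J_\emptyset$ under a contracting similarity of $\mathbb{R}^n$; and for $k\ge1$, $\sigma\in W_{k-1}$ and $1\le j\le n_k$ one has $J_{\sigma*j}\subset J_\sigma$ and $\operatorname{diam}J_{\sigma*j}/\operatorname{diam}J_\sigma=c_{k,j}$,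 the interiors of $J_{\sigma*j}$ and $J_{\sigma*l}$ being disjoint for $j\neq l$. -/

import Mathlib

open Set Filter Topology MeasureTheory
open scoped ENNReal Pointwise

noncomputable section

namespace RadixTile

/-- Similarities are contracting: all distances are multiplied by one `c ∈ (0, 1)`. -/
def IsSimilarity {X : Type*} [PseudoMetricSpace X] (f : X → X) : Prop :=
  ∃ c : ℝ, 0 < c ∧ c < 1 ∧ ∀ x y, dist (f x) (f y) = c * dist x y

variable {n : ℕ}

/-- An integer vector, seen as a point of Euclidean space. -/
def toVec (d : Fin n → ℤ) : EuclideanSpace ℝ (Fin n) :=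
  WithLp.toLp 2 (fun i => (d i : ℝ))

/-- Multiplication by `A⁻¹` on Euclidean space. -/
def invMap (A : Matrix (Fin n) (Fin n) ℤ) :
    EuclideanSpace ℝ (Fin n) →ₗ[ℝ] EuclideanSpace ℝ (Fin n) :=
  Matrix.toEuclideanLin (A.map (fun z : ℤ => (z : ℝ)))⁻¹

/-- The canonical map `𝒟 → ℤⁿ / Aℤⁿ` is bijective. -/
def IsCompleteResidueSystem (A : Matrix (Fin n) (Fin n) ℤ) (𝒟 : Set (Fin n → ℤ)) : Prop :=
  Function.Bijective
    (fun d : 𝒟 => Submodule.Quotient.mk (p := LinearMap.range A.mulVecLin) (d : Fin n → ℤ))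

/-- `a` is an `(A, D)`-representation of `x`: its digits lie in `D` and
`x = ∑_{j ≥ 1} A⁻ʲ a_j` (the digit `a_j` is `a (j - 1)` here). -/
def IsRepresentation (A : Matrix (Fin n) (Fin n) ℤ) (D : Set (Fin n → ℤ))
    (a : ℕ → Fin n → ℤ) (x : EuclideanSpace ℝ (Fin n)) : Prop :=
  (∀ j, a j ∈ D) ∧ HasSum (fun j => (invMap A ^ (j + 1)) (toVec (a j))) x

/-- The self-affine set `T_{A,D}`, the set of all points with an `(A, D)`-representation. -/
def selfAffineSet (A : Matrix (Fin n) (Fin n) ℤ) (D : Set (Fin n → ℤ)) :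
    Set (EuclideanSpace ℝ (Fin n)) :=
  {x | ∃ a, IsRepresentation A D a x}

/-- All `(A, D)`-representations are unique. -/
def UniqueRepresentations (A : Matrix (Fin n) (Fin n) ℤ) (D : Set (Fin n → ℤ)) : Prop :=
  ∀ x a b, IsRepresentation A D a x → IsRepresentation A D b x → a = b

/-- The translate `S + t`. -/
def translate (S : Set (EuclideanSpace ℝ (Fin n))) (t : EuclideanSpace ℝ (Fin n)) :
    Set (EuclideanSpace ℝ (Fin n)) :=
  (fun x => x + t) '' S

/-- `T_{A,D}` is a self-affine tile. -/
def IsSelfAffineTile (A : Matrix (Fin n) (Fin n) ℤ) (D : Set (Fin n → ℤ)) : Prop :=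
  selfAffineSet A D = closure (interior (selfAffineSet A D)) ∧
    ∀ d ∈ D, ∀ d' ∈ D, d ≠ d' →
      volume (translate (selfAffineSet A D) (toVec d) ∩
        translate (selfAffineSet A D) (toVec d')) = 0

/-- The intersection `T(α) = T_{A,D} ∩ (T_{A,D} + α)`. -/
def inter (A : Matrix (Fin n) (Fin n) ℤ) (D : Set (Fin n → ℤ))
    (α : EuclideanSpace ℝ (Fin n)) : Set (EuclideanSpace ℝ (Fin n)) :=
  selfAffineSet A D ∩ translate (selfAffineSet A D) α

/-- `F_{A,D}`, the translations `α` for which `T(α)` is nonempty. -/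
def nonemptyTranslations (A : Matrix (Fin n) (Fin n) ℤ) (D : Set (Fin n → ℤ)) :
    Set (EuclideanSpace ℝ (Fin n)) :=
  {α | (inter A D α).Nonempty}

/-- The function `Ψ_{A,D} : F_{A,D} → [0, dim_H T_{A,D}]`, `α ↦ dim_H T(α)`. -/
def Psi (A : Matrix (Fin n) (Fin n) ℤ) (D : Set (Fin n → ℤ)) :
    nonemptyTranslations A D → Icc (0 : ℝ≥0∞) (dimH (selfAffineSet A D)) :=
  fun α => ⟨dimH (inter A D α), bot_le, dimH_mono inter_subset_left⟩

/-- The smallest number of sets of diameter at most `δ` that cover `X`. -/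
def coverNumber {E : Type*} [PseudoEMetricSpace E] (X : Set E) (δ : ℝ) : ℕ∞ :=
  ⨅ (U : Set (Set E)) (_ : (∀ u ∈ U, Metric.ediam u ≤ ENNReal.ofReal δ) ∧ X ⊆ ⋃₀ U), U.encard

/-- The lower box-counting dimension: the lower limit of `log N_δ(X) / (-log δ)` as `δ ↓ 0`. -/
def lowerBoxDim {E : Type*} [PseudoEMetricSpace E] (X : Set E) : EReal :=
  liminf (fun δ : ℝ => ENNReal.log (coverNumber X δ : ℝ≥0∞) / ((-Real.log δ : ℝ) : EReal))
    (𝓝[>] 0)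

/-- The words of length `k` whose `i`-th letter (counted from `0`) is one of `0, …, N i - 1`. -/
def words (N : ℕ → ℕ) (k : ℕ) : Set (List ℕ) :=
  {σ | σ.length = k ∧ ∀ (i : ℕ) (hi : i < σ.length), σ[i] < N i}

/-- The family `(J σ)`, indexed by the words, satisfies the Moran structure given by the
branching numbers `N`, the ratios `c` and the compact set `J₀`. Values of `J` and `c` at indices
outside the range are not constrained. -/
structure IsMoranStructure (N : ℕ → ℕ) (c : ℕ → ℕ → ℝ) (J₀ : Set (EuclideanSpace ℝ (Fin n)))
    (J : List ℕ → Set (EuclideanSpace ℝ (Fin n))) : Prop where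
  branch_pos : ∀ k, 0 < N k
  ratio_mem : ∀ k, ∀ j < N k, 0 < c k j ∧ c k j < 1
  isCompact : IsCompact J₀
  interior_nonempty : (interior J₀).Nonempty
  root : J [] = J₀
  similar : ∀ k, ∀ σ ∈ words N (k + 1),
    ∃ S : EuclideanSpace ℝ (Fin n) → EuclideanSpace ℝ (Fin n), IsSimilarity S ∧ S '' J₀ = J σ
  nested : ∀ k, ∀ σ ∈ words N k, ∀ j < N k, J (σ ++ [j]) ⊆ J σ
  ratio : ∀ k, ∀ σ ∈ words N k, ∀ j < N k,
    Metric.diam (J (σ ++ [j])) / Metric.diam (J σ) = c k j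
  disjoint_interior : ∀ k, ∀ σ ∈ words N k, ∀ j < N k, ∀ l < N k, j ≠ l →
    Disjoint (interior (J (σ ++ [j]))) (interior (J (σ ++ [l])))

/-- `E` is the Moran set `⋂_{k ≥ 1} ⋃_{σ ∈ W_k} J_σ` of a family with some Moran structure. -/
def IsMoranSet (E : Set (EuclideanSpace ℝ (Fin n))) : Prop :=
  ∃ (N : ℕ → ℕ) (c : ℕ → ℕ → ℝ) (J₀ : Set (EuclideanSpace ℝ (Fin n)))
    (J : List ℕ → Set (EuclideanSpace ℝ (Fin n))),
    IsMoranStructure N c J₀ J ∧ E = ⋂ k : ℕ, ⋃ σ ∈ words N (k + 1), J σ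

end RadixTile

end

/-! The proof rests on digit sets: points $\sum A^{-j}d_j$ with $d_j$ in a nonempty
$D_j\subseteq\mathcal D$ that may depend on $j$. Write $\alpha=\sum A^{-j}a_j$ with $a_j\in D-D$. If
$x=y+\alpha$ with $x,y\in T_{A,D}$, uniqueness forces the digits of $x$ and $y$ to differ by exactly
$a_j$, so $T(\alpha)$ is the digit set with $D_j=D\cap(D+a_j)$ (`inter_eq_digitSet`).

Let $r$ be the contraction ratio. The Hausdorff and lower box dimensions of a digit set both equal
$\liminf_k \log\prod_{j\le k}|D_j|/(-k\log r)$. Covering by cylinders bounds the box dimension above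
(`lowerBoxDim_digitSet_le`). For the lower bound, choose digits independently and uniformly: a set
of diameter $r^k$ meets boundedly many cylinders of length $k$, since distinct words give distinct
integer points after multiplication by $A^k$. The mass distribution principle then applies
(`le_dimH_digitSet`).

The Moran pieces are the images of the tile $T_{A,\mathcal D}$ under the maps of finite words
(`isMoranSet_digitSet`). For density, keep a long prefix of $(a_j)$ and then mix the digit $0$,
whose overlap is all of $D$, with a digit whose overlap is a single point. The frequency of $0$
tunes the dimension from $0$ to $\dim_H T_{A,D}$ (`dense_preimage_Psi`). -/

noncomputable section

namespace RadixTile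

variable {n : ℕ}

/-! ### Integer vectors and residues mod $A$ -/

theorem toVec_add (x y : Fin n → ℤ) : toVec (x + y) = toVec x + toVec y := by
  ext i; simp [toVec]

theorem toVec_sub (x y : Fin n → ℤ) : toVec (x - y) = toVec x - toVec y := by
  ext i; simp [toVec]

theorem toVec_injective : Function.Injective (toVec : (Fin n → ℤ) → _) := by
  intro x y h
  funext i
  have := congrArg (fun v : EuclideanSpace ℝ (Fin n) => v i) h
  simpa [toVec] using this

theorem abs_le_norm_toVec (x : Fin n → ℤ) (i : Fin n) : |(x i : ℝ)| ≤ ‖toVec x‖ := by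
  simpa [toVec] using PiLp.norm_apply_le (toVec x) i

theorem finite_norm_toVec_le (R : ℝ) : {x : Fin n → ℤ | ‖toVec x‖ ≤ R}.Finite := by
  refine (Set.finite_Icc (fun _ : Fin n => -⌈R⌉) (fun _ => ⌈R⌉)).subset fun x hx => ?_
  have h : ∀ i, |x i| ≤ ⌈R⌉ := fun i => by
    have h1 : ((|x i| : ℤ) : ℝ) ≤ (⌈R⌉ : ℝ) := by
      rw [Int.cast_abs]
      exact (abs_le_norm_toVec x i).trans (le_trans hx (Int.le_ceil R))
    exact_mod_cast h1
  exact ⟨fun i => (abs_le.1 (h i)).1, fun i => (abs_le.1 (h i)).2⟩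

theorem invMap_toVec_mulVec {A : Matrix (Fin n) (Fin n) ℤ} (hA : A.det ≠ 0) (x : Fin n → ℤ) :
    invMap A (toVec (A.mulVec x)) = toVec x := by
  have hdet : IsUnit (A.map (fun z : ℤ => (z : ℝ))).det := by
    have : (A.map (fun z : ℤ => (z : ℝ))).det = (A.det : ℝ) :=
      ((Int.castRingHom ℝ).map_det A).symm
    rw [this, isUnit_iff_ne_zero]
    exact_mod_cast hA
  have h1 : (toVec (A.mulVec x)) =
      WithLp.toLp 2 ((A.map (fun z : ℤ => (z : ℝ))).mulVec (fun i => (x i : ℝ))) := by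
    ext i
    simp [toVec, Matrix.mulVec, dotProduct]
  rw [h1, invMap, Matrix.toLpLin_toLp, Matrix.toLin'_apply, Matrix.mulVec_mulVec, Matrix.nonsing_inv_mul _ hdet,
    Matrix.one_mulVec]
  rfl

/-- Since $A\,\mathrm{adj}(A)=\det A$, the nonzero integer $\det A$ kills $\mathbb Z^n/A\mathbb
Z^n$, and a finitely generated torsion group is finite. -/
theorem IsCompleteResidueSystem.finite {A : Matrix (Fin n) (Fin n) ℤ} (hA : A.det ≠ 0)
    {𝒟 : Set (Fin n → ℤ)} (h : IsCompleteResidueSystem A 𝒟) : 𝒟.Finite := by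
  have htor : Module.IsTorsion ℤ ((Fin n → ℤ) ⧸ LinearMap.range A.mulVecLin) := by
    intro x
    induction x using Submodule.Quotient.induction_on with
    | _ x =>
      refine ⟨⟨A.det, mem_nonZeroDivisors_of_ne_zero hA⟩, ?_⟩
      change A.det • (Submodule.Quotient.mk x : (Fin n → ℤ) ⧸ LinearMap.range A.mulVecLin) = 0
      rw [← Submodule.Quotient.mk_smul, Submodule.Quotient.mk_eq_zero]
      exact ⟨A.adjugate.mulVec x, by
        rw [Matrix.mulVecLin_apply, Matrix.mulVec_mulVec, Matrix.mul_adjugate, Matrix.smul_mulVec,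
          Matrix.one_mulVec]⟩
  have := Module.finite_of_fg_torsion _ htor
  have := Finite.of_injective _ h.1
  exact Set.toFinite 𝒟

/-- Uniqueness of division with remainder: reducing mod $A$ identifies the remainders, and
injectivity of $A$ the quotients. -/
theorem IsCompleteResidueSystem.eq_of_mulVec_add_eq {A : Matrix (Fin n) (Fin n) ℤ}
    (hA : A.det ≠ 0) {𝒟 : Set (Fin n → ℤ)} (h : IsCompleteResidueSystem A 𝒟)
    {x y d e : Fin n → ℤ} (hd : d ∈ 𝒟) (he : e ∈ 𝒟) (hxy : A.mulVec x + d = A.mulVec y + e) :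
    x = y ∧ d = e := by
  have hde : d = e := by
    have := @h.1 ⟨d, hd⟩ ⟨e, he⟩ ((Submodule.Quotient.eq _).2
      ⟨y - x, by rw [Matrix.mulVecLin_apply, Matrix.mulVec_sub]
                 linear_combination (-1 : ℤ) • hxy⟩)
    exact congrArg Subtype.val this
  refine ⟨?_, hde⟩
  rw [hde] at hxy
  have := congrArg (fun v => invMap A (toVec v)) (add_right_cancel hxy)
  simp only [invMap_toVec_mulVec hA] at this
  exact toVec_injective this

/-- The integer vector `∑_{j < k} A ^ (k - 1 - j) a_j`. -/
def integerPart (A : Matrix (Fin n) (Fin n) ℤ) (a : ℕ → Fin n → ℤ) : ℕ → Fin n → ℤ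
  | 0 => 0
  | k + 1 => A.mulVec (integerPart A a k) + a k

theorem eq_of_integerPart_eq {A : Matrix (Fin n) (Fin n) ℤ}
    (hA : A.det ≠ 0) {𝒟 : Set (Fin n → ℤ)} (h : IsCompleteResidueSystem A 𝒟)
    {a b : ℕ → Fin n → ℤ} (ha : ∀ j, a j ∈ 𝒟) (hb : ∀ j, b j ∈ 𝒟) {k : ℕ}
    (hab : integerPart A a k = integerPart A b k) : ∀ j < k, a j = b j := by
  induction k with
  | zero => simp
  | succ k ih =>
    obtain ⟨h1, h2⟩ := h.eq_of_mulVec_add_eq hA (ha k) (hb k) hab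
    intro j hj
    rcases Nat.lt_succ_iff_lt_or_eq.1 hj with hj | rfl
    exacts [ih h1 j hj, h2]

/-- Multiplying by $A^k$ turns the $k$-th partial sum into a lattice point; this is what separates
cylinders of length $k$ at scale $r^k$. -/
theorem pow_integerPart {A : Matrix (Fin n) (Fin n) ℤ} (hA : A.det ≠ 0) (a : ℕ → Fin n → ℤ)
    (k : ℕ) : (invMap A ^ k) (toVec (integerPart A a k)) =
      ∑ j ∈ Finset.range k, (invMap A ^ (j + 1)) (toVec (a j)) := by
  induction k with
  | zero => simp [integerPart, toVec]; rfl
  | succ k ih =>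
    rw [Finset.sum_range_succ, ← ih, integerPart, toVec_add, map_add, pow_succ, Module.End.mul_apply,
      invMap_toVec_mulVec hA]

/-! ### Radix expansions and digit sets -/

/-- The expansion `∑_{j ≥ 1} A⁻ʲ a_j`. -/
def expansion (A : Matrix (Fin n) (Fin n) ℤ) (a : ℕ → Fin n → ℤ) : EuclideanSpace ℝ (Fin n) :=
  ∑' j, (invMap A ^ (j + 1)) (toVec (a j))

theorem norm_pow_invMap {A : Matrix (Fin n) (Fin n) ℤ} {r : ℝ}
    (hr : ∀ x, ‖invMap A x‖ = r * ‖x‖) (k : ℕ) (x : EuclideanSpace ℝ (Fin n)) :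
    ‖(invMap A ^ k) x‖ = r ^ k * ‖x‖ := by
  induction k with
  | zero => simp
  | succ k ih => rw [pow_succ', Module.End.mul_apply, hr, ih, pow_succ']; ring

theorem norm_digit_le {A : Matrix (Fin n) (Fin n) ℤ} {r C : ℝ} (hr0 : 0 ≤ r)
    (hr : ∀ x, ‖invMap A x‖ = r * ‖x‖) {d : Fin n → ℤ} (hd : ‖toVec d‖ ≤ C) (j : ℕ) :
    ‖(invMap A ^ (j + 1)) (toVec d)‖ ≤ r ^ (j + 1) * C := by
  rw [norm_pow_invMap hr]
  gcongr

theorem hasSum_digit_bound {r : ℝ} (hr0 : 0 ≤ r) (hr1 : r < 1) (C : ℝ) :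
    HasSum (fun j : ℕ => r ^ (j + 1) * C) (r * C / (1 - r)) := by
  have := (hasSum_geometric_of_lt_one hr0 hr1).mul_left (r * C)
  rw [← div_eq_mul_inv] at this
  refine this.congr_fun fun j => ?_
  ring

theorem exists_norm_toVec_le {𝒟 : Set (Fin n → ℤ)} (h : 𝒟.Finite) :
    ∃ C : ℝ, 0 ≤ C ∧ ∀ d ∈ 𝒟, ‖toVec d‖ ≤ C := by
  obtain ⟨C, hC⟩ := (h.image fun d => ‖toVec d‖).bddAbove
  exact ⟨max C 0, le_max_right _ _, fun d hd => (hC ⟨d, hd, rfl⟩).trans (le_max_left _ _)⟩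

theorem summable_expansion {A : Matrix (Fin n) (Fin n) ℤ} {r C : ℝ} (hr0 : 0 ≤ r) (hr1 : r < 1)
    (hr : ∀ x, ‖invMap A x‖ = r * ‖x‖) {a : ℕ → Fin n → ℤ} (ha : ∀ j, ‖toVec (a j)‖ ≤ C) :
    Summable fun j => (invMap A ^ (j + 1)) (toVec (a j)) :=
  .of_norm_bounded (hasSum_digit_bound hr0 hr1 C).summable fun j => norm_digit_le hr0 hr (ha j) j

theorem norm_expansion_le {A : Matrix (Fin n) (Fin n) ℤ} {r C : ℝ} (hr0 : 0 ≤ r) (hr1 : r < 1)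
    (hr : ∀ x, ‖invMap A x‖ = r * ‖x‖) {a : ℕ → Fin n → ℤ} (ha : ∀ j, ‖toVec (a j)‖ ≤ C) :
    ‖expansion A a‖ ≤ r * C / (1 - r) :=
  tsum_of_norm_bounded (hasSum_digit_bound hr0 hr1 C) fun j => norm_digit_le hr0 hr (ha j) j

theorem continuous_invMap_pow (A : Matrix (Fin n) (Fin n) ℤ) (k : ℕ) : Continuous (invMap A ^ k) :=
  LinearMap.continuous_of_finiteDimensional _

theorem expansion_eq_sum_add {A : Matrix (Fin n) (Fin n) ℤ} {r C : ℝ} (hr0 : 0 ≤ r) (hr1 : r < 1)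
    (hr : ∀ x, ‖invMap A x‖ = r * ‖x‖) {a : ℕ → Fin n → ℤ} (ha : ∀ j, ‖toVec (a j)‖ ≤ C) (k : ℕ) :
    expansion A a = ∑ j ∈ Finset.range k, (invMap A ^ (j + 1)) (toVec (a j)) +
      (invMap A ^ k) (expansion A fun j => a (j + k)) := by
  rw [expansion, ← (summable_expansion hr0 hr1 hr ha).sum_add_tsum_nat_add k, expansion]
  congr 1
  have h := (summable_expansion hr0 hr1 hr (a := fun j => a (j + k)) fun j => ha (j + k)).map_tsum
    (invMap A ^ k) (continuous_invMap_pow A k)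
  rw [h]
  refine tsum_congr fun j => ?_
  rw [← Module.End.mul_apply, ← pow_add, show k + (j + 1) = j + k + 1 by ring]

/-- The points `∑_{j ≥ 1} A⁻ʲ d_j` with `d_j` in the `j`-th digit set. -/
def digitSet (A : Matrix (Fin n) (Fin n) ℤ) (D : ℕ → Set (Fin n → ℤ)) :
    Set (EuclideanSpace ℝ (Fin n)) :=
  {x | ∃ a, (∀ j, a j ∈ D j) ∧ expansion A a = x}

theorem isRepresentation_iff {A : Matrix (Fin n) (Fin n) ℤ} {r : ℝ} (hr0 : 0 ≤ r) (hr1 : r < 1)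
    (hr : ∀ x, ‖invMap A x‖ = r * ‖x‖) {D : Set (Fin n → ℤ)} (hD : D.Finite)
    {a : ℕ → Fin n → ℤ} {x : EuclideanSpace ℝ (Fin n)} :
    IsRepresentation A D a x ↔ (∀ j, a j ∈ D) ∧ expansion A a = x := by
  obtain ⟨C, -, hC⟩ := exists_norm_toVec_le hD
  refine and_congr_right fun h => ?_
  exact (summable_expansion hr0 hr1 hr fun j => hC _ (h j)).hasSum_iff

theorem selfAffineSet_eq_digitSet {A : Matrix (Fin n) (Fin n) ℤ} {r : ℝ} (hr0 : 0 ≤ r) (hr1 : r < 1)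
    (hr : ∀ x, ‖invMap A x‖ = r * ‖x‖) {D : Set (Fin n → ℤ)} (hD : D.Finite) :
    selfAffineSet A D = digitSet A fun _ => D := by
  ext x
  simp only [selfAffineSet, digitSet, isRepresentation_iff hr0 hr1 hr hD]

theorem continuous_expansion {A : Matrix (Fin n) (Fin n) ℤ} {r C : ℝ} (hr0 : 0 ≤ r) (hr1 : r < 1)
    (hr : ∀ x, ‖invMap A x‖ = r * ‖x‖) {D : ℕ → Set (Fin n → ℤ)}
    (hD : ∀ j, ∀ d ∈ D j, ‖toVec d‖ ≤ C) :
    Continuous fun a : ∀ j, D j => expansion A fun j => (a j : Fin n → ℤ) :=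
  continuous_tsum (fun j => (continuous_of_discreteTopology (f := fun d : D j =>
      (invMap A ^ (j + 1)) (toVec (d : Fin n → ℤ)))).comp (continuous_apply j))
    (hasSum_digit_bound hr0 hr1 C).summable fun j a => norm_digit_le hr0 hr (hD j _ (a j).2) j

theorem digitSet_eq_range (A : Matrix (Fin n) (Fin n) ℤ) (D : ℕ → Set (Fin n → ℤ)) :
    digitSet A D = range fun a : ∀ j, D j => expansion A fun j => (a j : Fin n → ℤ) := by
  ext x
  constructor
  · rintro ⟨a, ha, rfl⟩
    exact ⟨fun j => ⟨a j, ha j⟩, rfl⟩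
  · rintro ⟨a, rfl⟩
    exact ⟨_, fun j => (a j).2, rfl⟩

theorem isCompact_digitSet {A : Matrix (Fin n) (Fin n) ℤ} {r : ℝ} (hr0 : 0 ≤ r) (hr1 : r < 1)
    (hr : ∀ x, ‖invMap A x‖ = r * ‖x‖) {𝒟 : Set (Fin n → ℤ)} (h𝒟 : 𝒟.Finite)
    {D : ℕ → Set (Fin n → ℤ)} (hD : ∀ j, D j ⊆ 𝒟) : IsCompact (digitSet A D) := by
  obtain ⟨C, -, hC⟩ := exists_norm_toVec_le h𝒟
  have (j : ℕ) : Finite (D j) := (h𝒟.subset (hD j)).to_subtype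
  rw [digitSet_eq_range]
  exact isCompact_range (continuous_expansion hr0 hr1 hr fun j d hd => hC d (hD j hd))

/-! ### Covering numbers and lower box dimension -/

section BoxDimension

variable {E : Type*}

theorem exists_finset_cover_of_coverNumber_ne_top [PseudoEMetricSpace E] {X : Set E} {δ : ℝ}
    (h : coverNumber X δ ≠ ⊤) :
    ∃ U : Finset (Set E), (∀ u ∈ U, Metric.ediam u ≤ ENNReal.ofReal δ) ∧ X ⊆ ⋃₀ U ∧
      (U.card : ℕ∞) ≤ coverNumber X δ := by
  have h1 : coverNumber X δ < coverNumber X δ + 1 := ENat.lt_add_one_iff h |>.2 le_rfl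
  conv_lhs at h1 => rw [coverNumber]
  simp only [iInf_lt_iff] at h1
  obtain ⟨U, hU, hlt⟩ := h1
  have hle := (ENat.lt_add_one_iff h).1 hlt
  have hfin : U.Finite := Set.encard_ne_top_iff.1 (ne_top_of_le_ne_top h hle)
  refine ⟨hfin.toFinset, by simpa using hU.1, by simpa using hU.2, ?_⟩
  rwa [← hfin.encard_eq_coe_toFinset_card]

theorem one_le_coverNumber [PseudoEMetricSpace E] {X : Set E} (hX : X.Nonempty) (δ : ℝ) :
    1 ≤ coverNumber X δ := by
  refine le_iInf₂ fun U hU => ?_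
  obtain ⟨x, hx⟩ := hX
  obtain ⟨u, hu, -⟩ := hU.2 hx
  exact Set.one_le_encard_iff_nonempty.2 ⟨u, hu⟩

theorem eventually_pos_and_lt_one : ∀ᶠ δ : ℝ in 𝓝[>] 0, 0 < δ ∧ δ < 1 :=
  Ioo_mem_nhdsGT one_pos

theorem lowerBoxDim_nonneg [PseudoEMetricSpace E] {X : Set E} (hX : X.Nonempty) :
    0 ≤ lowerBoxDim X := by
  refine le_liminf_of_le (by isBoundedDefault) ?_
  filter_upwards [eventually_pos_and_lt_one] with δ hδ
  refine EReal.div_nonneg ?_ ?_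
  · rw [← ENNReal.log_one]
    exact ENNReal.log_monotone (by exact_mod_cast one_le_coverNumber hX δ)
  · exact_mod_cast (neg_pos.2 (Real.log_neg hδ.1 hδ.2)).le

/-- If the lower box dimension is below $q$, arbitrarily small $\delta$ satisfy
$N_\delta\,\delta^q\le1$. These covers give $\mathcal H^q(X)\le1$, hence $\dim_H X\le q$. -/
theorem dimH_le_lowerBoxDim [EMetricSpace E] {X : Set E} (hX : X.Nonempty) :
    ((dimH X : ℝ≥0∞) : EReal) ≤ lowerBoxDim X := by
  borelize E
  by_contra! h
  obtain ⟨q, hq1, hq2⟩ := EReal.lt_iff_exists_real_btwn.1 h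
  have hq0 : 0 ≤ q := by exact_mod_cast (lowerBoxDim_nonneg hX).trans hq1.le
  lift q to NNReal using hq0
  refine hq2.not_ge ?_
  have hmain : μH[q] X ≤ 1 := by
    have hfreq : ∃ᶠ δ : ℝ in 𝓝[>] 0, (0 < δ ∧ δ < 1) ∧
        ENNReal.log (coverNumber X δ : ℝ≥0∞) / ((-Real.log δ : ℝ) : EReal) < ((q : ℝ) : EReal) :=
      ((frequently_lt_of_liminf_lt (by isBoundedDefault) hq1).and_eventually
        eventually_pos_and_lt_one).mono fun δ h => ⟨h.2, h.1⟩
    have hcover : ∀ δ : ℝ, ∃ U : Finset (Set E), ((0 < δ ∧ δ < 1) ∧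
        ENNReal.log (coverNumber X δ : ℝ≥0∞) / ((-Real.log δ : ℝ) : EReal) < ((q : ℝ) : EReal)) →
        (∀ u ∈ U, Metric.ediam u ≤ ENNReal.ofReal δ) ∧ X ⊆ ⋃₀ U ∧
        (U.card : ℝ≥0∞) * ENNReal.ofReal δ ^ (q : ℝ) ≤ 1 := by
      intro δ
      by_cases hδ : ((0 < δ ∧ δ < 1) ∧
        ENNReal.log (coverNumber X δ : ℝ≥0∞) / ((-Real.log δ : ℝ) : EReal) < ((q : ℝ) : EReal))
      swap
      · exact ⟨∅, fun h => absurd h hδ⟩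
      obtain ⟨⟨h0, h1⟩, h2⟩ := hδ
      have hlog : 0 < -Real.log δ := neg_pos.2 (Real.log_neg h0 h1)
      rw [EReal.div_lt_iff (by exact_mod_cast hlog) (EReal.coe_ne_top _)] at h2
      have h3 : (coverNumber X δ : ℝ≥0∞) < ENNReal.ofReal δ ^ (-(q : ℝ)) := by
        refine ENNReal.log_lt_log_iff.1 (h2.trans_eq ?_)
        rw [ENNReal.log_rpow, ENNReal.log_ofReal_of_pos h0]
        norm_cast
        ring_nf
      have htop : coverNumber X δ ≠ ⊤ := by
        intro htop
        rw [htop] at h3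
        simp at h3
      obtain ⟨U, hU1, hU2, hU3⟩ := exists_finset_cover_of_coverNumber_ne_top htop
      refine ⟨U, fun _ => ⟨hU1, hU2, ?_⟩⟩
      have hU4 : (U.card : ℝ≥0∞) ≤ (coverNumber X δ : ℝ≥0∞) := by exact_mod_cast hU3
      calc (U.card : ℝ≥0∞) * ENNReal.ofReal δ ^ (q : ℝ)
          ≤ ENNReal.ofReal δ ^ (-(q : ℝ)) * ENNReal.ofReal δ ^ (q : ℝ) := by
            gcongr
            exact hU4.trans h3.le
        _ = 1 := by
            rw [← ENNReal.rpow_add _ _ (by simpa using h0) ENNReal.ofReal_ne_top]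
            simp
    choose U hU using hcover
    set S : Set ℝ := {δ | (0 < δ ∧ δ < 1) ∧
        ENNReal.log (coverNumber X δ : ℝ≥0∞) / ((-Real.log δ : ℝ) : EReal) < ((q : ℝ) : EReal)}
    -- The good scales are only frequent near $0$, so the limit is taken along the filter restricted
    -- to them.
    have : NeBot (𝓝[>] (0 : ℝ) ⊓ 𝓟 S) := frequently_mem_iff_neBot.1 hfreq
    have hS : ∀ᶠ δ in 𝓝[>] (0 : ℝ) ⊓ 𝓟 S, δ ∈ S := mem_inf_of_right (mem_principal_self S)
    have hr : Tendsto ENNReal.ofReal (𝓝[>] (0 : ℝ) ⊓ 𝓟 S) (𝓝 0) := by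
      have h1 : Tendsto ENNReal.ofReal (𝓝 0) (𝓝 (ENNReal.ofReal 0)) :=
        ENNReal.continuous_ofReal.tendsto 0
      rw [ENNReal.ofReal_zero] at h1
      exact h1.mono_left (inf_le_left.trans nhdsWithin_le_nhds)
    refine (Measure.hausdorffMeasure_le_liminf_sum (ι := fun δ => U δ) (q : ℝ) X
      (fun δ => ENNReal.ofReal δ) hr (fun δ u => u.1) ?_ ?_).trans ?_
    · filter_upwards [hS] with δ hδ u
      exact (hU δ hδ).1 u.1 u.2
    · filter_upwards [hS] with δ hδ
      intro x hx
      obtain ⟨u, hu, hxu⟩ := (hU δ hδ).2.1 hx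
      exact mem_iUnion.2 ⟨⟨u, hu⟩, hxu⟩
    · refine liminf_le_of_frequently_le (Eventually.frequently ?_) (by isBoundedDefault)
      filter_upwards [hS] with δ hδ
      refine le_trans ?_ (hU δ hδ).2.2
      calc ∑ u : U δ, Metric.ediam u.1 ^ (q : ℝ)
          ≤ ∑ u : U δ, ENNReal.ofReal δ ^ (q : ℝ) := by
            gcongr with u
            exact (hU δ hδ).1 u.1 u.2
        _ = _ := by simp
  have := dimH_le_of_hausdorffMeasure_ne_top (ne_top_of_le_ne_top ENNReal.one_ne_top hmain)
  exact (EReal.coe_ennreal_le_coe_ennreal_iff.2 this).trans_eq (EReal.coe_nnreal_eq_coe_real q)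

end BoxDimension

/-! ### Upper bound: covering by cylinders -/

theorem dist_expansion_le {A : Matrix (Fin n) (Fin n) ℤ} {r C : ℝ} (hr0 : 0 ≤ r) (hr1 : r < 1)
    (hr : ∀ x, ‖invMap A x‖ = r * ‖x‖) {a b : ℕ → Fin n → ℤ} (ha : ∀ j, ‖toVec (a j)‖ ≤ C)
    (hb : ∀ j, ‖toVec (b j)‖ ≤ C) {k : ℕ} (hab : ∀ j < k, a j = b j) :
    dist (expansion A a) (expansion A b) ≤ r ^ k * (2 * (r * C / (1 - r))) := by
  rw [expansion_eq_sum_add hr0 hr1 hr ha k, expansion_eq_sum_add hr0 hr1 hr hb k,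
    Finset.sum_congr rfl fun j hj => by rw [hab j (Finset.mem_range.1 hj)], dist_add_left,
    dist_eq_norm, ← map_sub, norm_pow_invMap hr, two_mul]
  gcongr
  exact (norm_sub_le _ _).trans (add_le_add (norm_expansion_le hr0 hr1 hr fun j => ha (j + k))
    (norm_expansion_le hr0 hr1 hr fun j => hb (j + k)))

theorem coverNumber_digitSet_le {A : Matrix (Fin n) (Fin n) ℤ} {r C : ℝ} (hr0 : 0 ≤ r) (hr1 : r < 1)
    (hr : ∀ x, ‖invMap A x‖ = r * ‖x‖) {D : ℕ → Finset (Fin n → ℤ)}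
    (hD : ∀ j, ∀ d ∈ D j, ‖toVec d‖ ≤ C) (k : ℕ) {δ : ℝ}
    (hδ : r ^ k * (2 * (r * C / (1 - r))) ≤ δ) :
    coverNumber (digitSet A fun j => (D j : Set (Fin n → ℤ))) δ ≤
      ((∏ j ∈ Finset.range k, (D j).card : ℕ) : ℕ∞) := by
  let f : (∀ j : Fin k, D j) → Set (EuclideanSpace ℝ (Fin n)) := fun w =>
    {x | ∃ a, (∀ j, a j ∈ D j) ∧ (∀ j : Fin k, a j = (w j : Fin n → ℤ)) ∧ expansion A a = x}
  have hle : coverNumber (digitSet A fun j => (D j : Set (Fin n → ℤ))) δ ≤ (range f).encard := by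
    refine iInf₂_le (range f) ⟨?_, ?_⟩
    · rintro _ ⟨w, rfl⟩
      refine Metric.ediam_le ?_
      rintro _ ⟨a, ha, haw, rfl⟩ _ ⟨b, hb, hbw, rfl⟩
      rw [edist_dist]
      refine ENNReal.ofReal_le_ofReal (le_trans ?_ hδ)
      exact dist_expansion_le hr0 hr1 hr (fun j => hD j _ (ha j)) (fun j => hD j _ (hb j))
        fun j hj => (haw ⟨j, hj⟩).trans (hbw ⟨j, hj⟩).symm
    · rintro _ ⟨a, ha, rfl⟩
      exact ⟨_, ⟨fun j => ⟨a j, ha j⟩, rfl⟩, a, ha, fun j => rfl, rfl⟩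
  refine hle.trans ?_
  rw [← image_univ]
  refine (encard_image_le f univ).trans ?_
  rw [encard_univ, ENat.card_eq_coe_fintype_card, Fintype.card_pi]
  simp [Finset.prod_range]

theorem lowerBoxDim_digitSet_le {A : Matrix (Fin n) (Fin n) ℤ} {r : ℝ} (hr0 : 0 < r) (hr1 : r < 1)
    (hr : ∀ x, ‖invMap A x‖ = r * ‖x‖) {𝒟 : Set (Fin n → ℤ)} (h𝒟 : 𝒟.Finite)
    {D : ℕ → Finset (Fin n → ℤ)} (hD : ∀ j, ↑(D j) ⊆ 𝒟) {s t : ℝ} (hst : s < t)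
    (hs : ∃ᶠ k : ℕ in atTop, (r ^ k) ^ s * ∏ j ∈ Finset.range k, ((D j).card : ℝ) ≤ 1) :
    lowerBoxDim (digitSet A fun j => (D j : Set (Fin n → ℤ))) ≤ t := by
  obtain ⟨C, hC0, hC⟩ := exists_norm_toVec_le h𝒟
  -- Cylinders of length $k$ have diameter at most $r^k(c-1)$; the extra $1$ keeps $c$ positive even
  -- when $C=0$.
  set c : ℝ := 2 * (r * C / (1 - r)) + 1 with hc
  have h1r : 0 < 1 - r := by linarith
  have hc0 : 0 < c := by positivity
  have hl : 0 < -Real.log r := neg_pos.2 (Real.log_neg hr0 hr1)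
  have hlim0 : Tendsto (fun k : ℕ => r ^ k * c) atTop (𝓝 0) := by
    simpa using (tendsto_pow_atTop_nhds_zero_of_lt_one hr0.le hr1).mul_const c
  have hlim : Tendsto (fun k : ℕ => r ^ k * c) atTop (𝓝[>] 0) :=
    tendsto_nhdsWithin_iff.2 ⟨hlim0, Eventually.of_forall fun k => mem_Ioi.2 (by positivity)⟩
  have hev1 : ∀ᶠ k : ℕ in atTop, r ^ k * c < 1 := hlim0.eventually_lt_const one_pos
  -- The gap $t-s$ absorbs the constant $c$: for large $k$ this gives $(r^k)^{-s}\le(r^kc)^{-t}$.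
  have hev2 : ∀ᶠ k : ℕ in atTop, t * Real.log c ≤ k * ((t - s) * -Real.log r) :=
    (tendsto_natCast_atTop_atTop.atTop_mul_const
      (mul_pos (sub_pos.2 hst) hl)).eventually_ge_atTop _
  refine liminf_le_of_frequently_le (hlim.frequently
    ((hs.and_eventually (hev1.and hev2)).mono ?_)) (by isBoundedDefault)
  rintro k ⟨h1, h2, h3⟩
  have hδ0 : 0 < r ^ k * c := by positivity
  have hlog : 0 < -Real.log (r ^ k * c) := neg_pos.2 (Real.log_neg hδ0 h2)
  rw [EReal.div_le_iff_le_mul (by exact_mod_cast hlog) (EReal.coe_ne_top _)]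
  have hle : r ^ k * (2 * (r * C / (1 - r))) ≤ r ^ k * c := by
    gcongr
    linarith
  have hN := coverNumber_digitSet_le hr0.le hr1 hr (fun j d hd => hC d (hD j hd)) k hle
  have hpow : 0 < r ^ k := by positivity
  have hP : (∏ j ∈ Finset.range k, ((D j).card : ℝ)) ≤ (r ^ k) ^ (-s) := by
    rw [Real.rpow_neg hpow.le, ← one_div, le_div_iff₀ (by positivity), mul_comm]
    exact h1
  have hN2 : (coverNumber (digitSet A fun j => (D j : Set (Fin n → ℤ))) (r ^ k * c) : ℝ≥0∞) ≤
      ENNReal.ofReal ((r ^ k) ^ (-s)) := by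
    refine ((ENat.toENNReal_le.2 hN).trans_eq (ENat.toENNReal_coe _)).trans ?_
    rw [← ENNReal.ofReal_natCast]
    refine ENNReal.ofReal_le_ofReal ?_
    push_cast
    exact hP
  refine (ENNReal.log_monotone hN2).trans ?_
  rw [ENNReal.log_ofReal_of_pos (by positivity), ← EReal.coe_mul, EReal.coe_le_coe_iff,
    Real.log_rpow hpow, Real.log_mul hpow.ne' hc0.ne', Real.log_pow]
  linarith

/-! ### Lower bound: mass distribution -/

/-- The uniform distribution on each digit set, with independent digits. -/
def digitMeasure (D : ℕ → Finset (Fin n → ℤ)) [∀ j, Nonempty (D j)] : Measure (∀ j, D j) :=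
  Measure.infinitePi fun j => (PMF.uniformOfFintype (D j)).toMeasure

instance (D : ℕ → Finset (Fin n → ℤ)) [∀ j, Nonempty (D j)] :
    IsProbabilityMeasure (digitMeasure D) := by
  unfold digitMeasure; infer_instance

theorem digitMeasure_cylinder (D : ℕ → Finset (Fin n → ℤ)) [∀ j, Nonempty (D j)] (k : ℕ)
    (b : ∀ j, D j) : digitMeasure D {a | ∀ j < k, a j = b j} =
      ∏ j ∈ Finset.range k, ((D j).card : ℝ≥0∞)⁻¹ := by
  have h : {a : ∀ j, D j | ∀ j < k, a j = b j} =
      (↑(Finset.range k) : Set ℕ).pi fun j => {b j} := by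
    ext a; simp [Set.mem_pi]
  rw [h, digitMeasure, Measure.infinitePi_pi _ fun j _ => measurableSet_singleton _]
  refine Finset.prod_congr rfl fun j _ => ?_
  rw [PMF.toMeasure_uniformOfFintype_apply _ (measurableSet_singleton _)]
  simp

/-- Rescaled by $A^k$, the integer parts of two points of $W$ differ by a lattice vector of bounded
norm, so there are finitely many differences, independently of $k$ and $W$. By the residue property
each integer part determines a single cylinder. -/
theorem exists_digitMeasure_preimage_le {A : Matrix (Fin n) (Fin n) ℤ} (hA : A.det ≠ 0) {r : ℝ}
    (hr0 : 0 < r) (hr1 : r < 1) (hr : ∀ x, ‖invMap A x‖ = r * ‖x‖) {𝒟 : Set (Fin n → ℤ)}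
    (h𝒟 : IsCompleteResidueSystem A 𝒟) (D : ℕ → Finset (Fin n → ℤ)) [∀ j, Nonempty (D j)]
    (hD : ∀ j, ↑(D j) ⊆ 𝒟) :
    ∃ M : ℕ, ∀ (k : ℕ) (W : Set (EuclideanSpace ℝ (Fin n))),
      Metric.ediam W ≤ ENNReal.ofReal (r ^ k) →
      digitMeasure D ((fun a : ∀ j, D j => expansion A fun j => (a j : Fin n → ℤ)) ⁻¹' W) ≤
        M * ∏ j ∈ Finset.range k, ((D j).card : ℝ≥0∞)⁻¹ := by
  obtain ⟨C, hC0, hC⟩ := exists_norm_toVec_le (h𝒟.finite hA)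
  set R : ℝ := r * C / (1 - r) with hR
  -- The $1$ comes from the diameter $r^k$ of $W$ after rescaling, and $2R$ from the two tails.
  set F := (finite_norm_toVec_le (n := n) (1 + 2 * R)).toFinset
  refine ⟨F.card, fun k W hW => ?_⟩
  set φ : (∀ j, D j) → EuclideanSpace ℝ (Fin n) :=
    fun a => expansion A fun j => (a j : Fin n → ℤ) with hφ
  let z : (∀ j, D j) → Fin n → ℤ := fun a => integerPart A (fun j => (a j : Fin n → ℤ)) k
  have hCa : ∀ (a : ∀ j, D j) (j : ℕ), ‖toVec (a j : Fin n → ℤ)‖ ≤ C :=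
    fun a j => hC _ (hD j (a j).2)
  rcases (φ ⁻¹' W).eq_empty_or_nonempty with hempty | ⟨a₀, ha₀⟩
  · simp [hempty]
  have hsub : φ ⁻¹' W ⊆ ⋃ v ∈ F, {a | z a = z a₀ + v} := by
    intro a ha
    simp only [mem_iUnion, mem_ofPred_eq]
    refine ⟨z a - z a₀, ?_, by abel⟩
    simp only [F, Set.Finite.mem_toFinset, mem_ofPred_eq]
    have hdist : dist (φ a) (φ a₀) ≤ r ^ k := by
      have := (Metric.edist_le_ediam_of_mem (x := φ a) (y := φ a₀) ha ha₀).trans hW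
      rwa [edist_dist, ENNReal.ofReal_le_ofReal_iff (by positivity)] at this
    have hz : ∀ a, φ a = (invMap A ^ k) (toVec (z a)) +
        (invMap A ^ k) (expansion A fun j => (a (j + k) : Fin n → ℤ)) := fun a => by
      rw [pow_integerPart hA]
      exact expansion_eq_sum_add hr0.le hr1 hr (hCa a) k
    have hzsub : (invMap A ^ k) (toVec (z a - z a₀)) = (φ a - φ a₀) -
        (invMap A ^ k) ((expansion A fun j => (a (j + k) : Fin n → ℤ)) -
          expansion A fun j => (a₀ (j + k) : Fin n → ℤ)) := by
      rw [hz, hz, toVec_sub, map_sub, map_sub]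
      abel
    have hpow : 0 < r ^ k := by positivity
    have hnorm := norm_sub_le (φ a - φ a₀) ((invMap A ^ k)
      ((expansion A fun j => (a (j + k) : Fin n → ℤ)) -
          expansion A fun j => (a₀ (j + k) : Fin n → ℤ)))
    rw [← hzsub, norm_pow_invMap hr, norm_pow_invMap hr, ← dist_eq_norm] at hnorm
    have h1 := norm_sub_le (expansion A fun j => (a (j + k) : Fin n → ℤ))
      (expansion A fun j => (a₀ (j + k) : Fin n → ℤ))
    have h2 := norm_expansion_le hr0.le hr1 hr fun j => hCa a (j + k)
    have h3 := norm_expansion_le hr0.le hr1 hr fun j => hCa a₀ (j + k)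
    refine le_of_mul_le_mul_left (hnorm.trans ?_) hpow
    rw [mul_add, mul_one]
    gcongr
    linarith
  refine (measure_mono hsub).trans ((measure_biUnion_finset_le _ _).trans ?_)
  rw [← nsmul_eq_mul]
  refine Finset.sum_le_card_nsmul _ _ _ fun v _ => ?_
  rcases {a | z a = z a₀ + v}.eq_empty_or_nonempty with hempty | ⟨b, hb⟩
  · simp [hempty]
  rw [← digitMeasure_cylinder D k b]
  refine measure_mono fun a ha j hj => Subtype.ext ?_
  exact eq_of_integerPart_eq hA h𝒟 (fun j => hD j (a j).2) (fun j => hD j (b j).2)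
    (ha.trans hb.symm) j hj

theorem le_dimH_digitSet {A : Matrix (Fin n) (Fin n) ℤ} (hA : A.det ≠ 0) {r : ℝ}
    (hr0 : 0 < r) (hr1 : r < 1) (hr : ∀ x, ‖invMap A x‖ = r * ‖x‖) {𝒟 : Set (Fin n → ℤ)}
    (h𝒟 : IsCompleteResidueSystem A 𝒟) {D : ℕ → Finset (Fin n → ℤ)} (hne : ∀ j, (D j).Nonempty)
    (hD : ∀ j, ↑(D j) ⊆ 𝒟) {s : NNReal}
    (hs : ∀ᶠ k : ℕ in atTop, 1 ≤ (r ^ k) ^ (s : ℝ) * ∏ j ∈ Finset.range k, ((D j).card : ℝ)) :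
    (s : ℝ≥0∞) ≤ dimH (digitSet A fun j => (D j : Set (Fin n → ℤ))) := by
  have (j : ℕ) : Nonempty (D j) := (hne j).to_subtype
  rcases eq_or_ne s 0 with rfl | hs0
  · simp
  have hs0 : (0 : ℝ) < s := by exact_mod_cast pos_iff_ne_zero.2 hs0
  obtain ⟨C, hC0, hC⟩ := exists_norm_toVec_le (h𝒟.finite hA)
  set φ : (∀ j, D j) → EuclideanSpace ℝ (Fin n) :=
    fun a => expansion A fun j => (a j : Fin n → ℤ) with hφ
  have hφm : Measurable φ := (continuous_expansion (D := fun j => (D j : Set (Fin n → ℤ)))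
    hr0.le hr1 hr fun j d hd => hC d (hD j hd)).measurable
  obtain ⟨M, hM⟩ := exists_digitMeasure_preimage_le hA hr0 hr1 hr h𝒟 D hD
  obtain ⟨K, hK⟩ := eventually_atTop.1 hs
  set ν := (digitMeasure D).map φ with hν
  have hbound : ∀ k ≥ K, ∀ W : Set (EuclideanSpace ℝ (Fin n)),
      Metric.ediam W ≤ ENNReal.ofReal (r ^ k) →
      ν W ≤ (M + 1) * ENNReal.ofReal (r ^ k) ^ (s : ℝ) := by
    intro k hk W hW
    have hprod : ∏ j ∈ Finset.range k, ((D j).card : ℝ≥0∞)⁻¹ ≤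
        ENNReal.ofReal (r ^ k) ^ (s : ℝ) := by
      have h1 := ENNReal.ofReal_le_ofReal (hK k hk)
      have hpow : 0 ≤ r ^ k := by positivity
      rw [ENNReal.ofReal_one, ENNReal.ofReal_mul (by positivity),
        ← ENNReal.ofReal_rpow_of_nonneg hpow hs0.le,
        ENNReal.ofReal_prod_of_nonneg fun _ _ => by positivity] at h1
      simp only [ENNReal.ofReal_natCast] at h1
      rw [← ENNReal.prod_inv_distrib (by simp [Set.Pairwise])]
      rw [ENNReal.inv_le_iff_le_mul]
      · rwa [mul_comm]
      · exact fun h => absurd h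
          (ENNReal.rpow_ne_top_of_nonneg hs0.le ENNReal.ofReal_ne_top)
      · exact fun h => absurd h (ENNReal.prod_ne_top fun j _ => ENNReal.natCast_ne_top _)
    -- `Measure.map_apply` needs a measurable set; passing to the closure supplies one without
    -- changing the diameter.
    calc ν W ≤ ν (closure W) := measure_mono subset_closure
      _ = digitMeasure D (φ ⁻¹' closure W) :=
        Measure.map_apply hφm isClosed_closure.measurableSet
      _ ≤ M * ∏ j ∈ Finset.range k, ((D j).card : ℝ≥0∞)⁻¹ :=
        hM k _ (by rwa [Metric.ediam_closure])
      _ ≤ (M + 1) * ENNReal.ofReal (r ^ k) ^ (s : ℝ) := by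
        gcongr
        exact le_self_add
  -- The factor $r^{-s}$ pays for rounding the diameter $x$ up to $r^k$, where $r^{k+1}<x\le r^k$.
  set c : ℝ≥0∞ := (M + 1) * ENNReal.ofReal r⁻¹ ^ (s : ℝ) with hc
  have hc0 : c ≠ 0 := by
    refine mul_ne_zero (by simp) (ENNReal.rpow_pos ?_ ENNReal.ofReal_ne_top).ne'
    simpa using hr0
  have hctop : c ≠ ⊤ := ENNReal.mul_ne_top (by simp)
    (ENNReal.rpow_ne_top_of_nonneg hs0.le ENNReal.ofReal_ne_top)
  have hν_le : ∀ W : Set (EuclideanSpace ℝ (Fin n)), Metric.ediam W ≤ ENNReal.ofReal (r ^ K) →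
      ν W ≤ c * Metric.ediam W ^ (s : ℝ) := by
    intro W hW
    -- A set of diameter $0$ lies below every scale $r^k$, so its mass is at most the limit of the
    -- bounds, which is $0$.
    rcases eq_or_ne (Metric.ediam W) 0 with h0 | h0
    · rw [h0, ENNReal.zero_rpow_of_pos hs0, mul_zero]
      have hlim : Tendsto (fun k : ℕ => (M + 1) * ENNReal.ofReal (r ^ k) ^ (s : ℝ)) atTop (𝓝 0) := by
        have h1 := (ENNReal.continuous_ofReal.tendsto 0).comp
          (tendsto_pow_atTop_nhds_zero_of_lt_one hr0.le hr1)
        have h2 := ((ENNReal.continuous_rpow_const (y := (s : ℝ))).tendsto _).comp h1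
        have h3 := ENNReal.Tendsto.const_mul (a := (M + 1 : ℝ≥0∞)) h2 (Or.inr (by simp))
        simpa [ENNReal.zero_rpow_of_pos hs0] using h3
      refine ge_of_tendsto hlim ?_
      filter_upwards [eventually_ge_atTop K] with k hk
      exact hbound k hk W (by simp [h0])
    · have htop : Metric.ediam W ≠ ⊤ := ne_top_of_le_ne_top ENNReal.ofReal_ne_top hW
      set x : ℝ := (Metric.ediam W).toReal with hx
      have hWx : Metric.ediam W = ENNReal.ofReal x := (ENNReal.ofReal_toReal htop).symm
      have hx0 : 0 < x := ENNReal.toReal_pos h0 htop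
      have hxK : x ≤ r ^ K := by
        rwa [hWx, ENNReal.ofReal_le_ofReal_iff (by positivity)] at hW
      obtain ⟨k, hk1, hk2⟩ := exists_nat_pow_near_of_lt_one hx0
        (hxK.trans (pow_le_one₀ hr0.le hr1.le)) hr0 hr1
      have hkK : K ≤ k := by
        by_contra! hlt
        exact absurd (hk1.trans_le hxK) (pow_le_pow_of_le_one hr0.le hr1.le hlt).not_gt
      refine (hbound k hkK W (hWx ▸ ENNReal.ofReal_le_ofReal hk2)).trans ?_
      rw [hWx, hc, mul_assoc, ← ENNReal.mul_rpow_of_nonneg _ _ hs0.le,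
        ← ENNReal.ofReal_mul (by positivity)]
      gcongr
      rw [inv_mul_eq_div, le_div_iff₀ hr0, ← pow_succ]
      exact hk1.le
  have hle : c⁻¹ • ν ≤ μH[s] := by
    refine Measure.le_hausdorffMeasure _ _ (ENNReal.ofReal (r ^ K)) (by simp; positivity)
      fun W hW => ?_
    rw [Measure.smul_apply, smul_eq_mul]
    calc c⁻¹ * ν W ≤ c⁻¹ * (c * Metric.ediam W ^ (s : ℝ)) := by gcongr; exact hν_le W hW
      _ = Metric.ediam W ^ (s : ℝ) := by rw [← mul_assoc, ENNReal.inv_mul_cancel hc0 hctop, one_mul]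
  refine le_dimH_of_hausdorffMeasure_ne_zero (ne_of_gt ?_)
  refine lt_of_lt_of_le ?_ (hle _)
  have hmeas : MeasurableSet (digitSet A fun j => (D j : Set (Fin n → ℤ))) :=
    (isCompact_digitSet hr0.le hr1 hr (h𝒟.finite hA) hD).isClosed.measurableSet
  have huniv : φ ⁻¹' (digitSet A fun j => (D j : Set (Fin n → ℤ))) = univ :=
    eq_univ_of_forall fun a => ⟨_, fun j => (a j).2, rfl⟩
  rw [Measure.smul_apply, hν, Measure.map_apply hφm hmeas, huniv, measure_univ, smul_eq_mul, mul_one]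
  exact ENNReal.inv_pos.2 hctop

/-! ### Dimension of digit sets -/

/-- For each $s$ there is a dichotomy: either $\prod_{j\le k}|D_j|\le r^{-ks}$ for infinitely many
$k$, which bounds the box dimension by any $t>s$, or the reverse holds eventually, which gives
$\dim_H\ge s$. Hence no $s<t$ fit strictly between the two dimensions. -/
theorem dimH_digitSet_eq_lowerBoxDim {A : Matrix (Fin n) (Fin n) ℤ} (hA : A.det ≠ 0) {r : ℝ}
    (hr0 : 0 < r) (hr1 : r < 1) (hr : ∀ x, ‖invMap A x‖ = r * ‖x‖) {𝒟 : Set (Fin n → ℤ)}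
    (h𝒟 : IsCompleteResidueSystem A 𝒟) {D : ℕ → Finset (Fin n → ℤ)} (hne : ∀ j, (D j).Nonempty)
    (hD : ∀ j, ↑(D j) ⊆ 𝒟) :
    ((dimH (digitSet A fun j => (D j : Set (Fin n → ℤ))) : ℝ≥0∞) : EReal) =
      lowerBoxDim (digitSet A fun j => (D j : Set (Fin n → ℤ))) := by
  choose a ha using hne
  refine le_antisymm (dimH_le_lowerBoxDim ⟨_, a, ha, rfl⟩) ?_
  by_contra! h
  obtain ⟨t, ht1, ht2⟩ := EReal.lt_iff_exists_real_btwn.1 h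
  obtain ⟨s, hs1, hs2⟩ := EReal.lt_iff_exists_real_btwn.1 ht1
  have hst : s < t := by exact_mod_cast hs2
  have hs0 : 0 ≤ s := by exact_mod_cast (EReal.coe_ennreal_nonneg _).trans hs1.le
  lift s to NNReal using hs0
  have hnot : ¬ ∃ᶠ k : ℕ in atTop, (r ^ k) ^ (s : ℝ) * ∏ j ∈ Finset.range k, ((D j).card : ℝ) ≤ 1 :=
    fun hf => ht2.not_ge (lowerBoxDim_digitSet_le hr0 hr1 hr (h𝒟.finite hA) hD hst hf)
  rw [not_frequently] at hnot
  have := le_dimH_digitSet hA hr0 hr1 hr h𝒟 (fun j => ⟨a j, ha j⟩) hD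
    (hnot.mono fun k hk => (not_le.1 hk).le)
  refine hs1.not_ge ?_
  rw [← EReal.coe_nnreal_eq_coe_real]
  exact EReal.coe_ennreal_le_coe_ennreal_iff.2 this

theorem dimH_digitSet_of_tendsto {A : Matrix (Fin n) (Fin n) ℤ} (hA : A.det ≠ 0) {r : ℝ}
    (hr0 : 0 < r) (hr1 : r < 1) (hr : ∀ x, ‖invMap A x‖ = r * ‖x‖) {𝒟 : Set (Fin n → ℤ)}
    (h𝒟 : IsCompleteResidueSystem A 𝒟) {D : ℕ → Finset (Fin n → ℤ)} (hne : ∀ j, (D j).Nonempty)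
    (hD : ∀ j, ↑(D j) ⊆ 𝒟) {t : ℝ}
    (ht : Tendsto (fun k : ℕ => (∑ j ∈ Finset.range k, Real.log (D j).card) / k) atTop
      (𝓝 (t * -Real.log r))) :
    dimH (digitSet A fun j => (D j : Set (Fin n → ℤ))) = ENNReal.ofReal t := by
  have hl : 0 < -Real.log r := neg_pos.2 (Real.log_neg hr0 hr1)
  have hcard : ∀ j, (0 : ℝ) < (D j).card := fun j => by exact_mod_cast (hne j).card_pos
  have hlog : ∀ (k : ℕ) (s : ℝ), Real.log ((r ^ k) ^ s * ∏ j ∈ Finset.range k, ((D j).card : ℝ)) =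
      (∑ j ∈ Finset.range k, Real.log (D j).card) - k * (s * -Real.log r) := fun k s => by
    rw [Real.log_mul (by positivity) (Finset.prod_pos fun j _ => hcard j).ne',
      Real.log_rpow (by positivity), Real.log_pow, Real.log_prod fun j _ => (hcard j).ne']
    ring
  have hpos : ∀ (k : ℕ) (s : ℝ), 0 < (r ^ k) ^ s * ∏ j ∈ Finset.range k, ((D j).card : ℝ) :=
    fun k s => mul_pos (by positivity) (Finset.prod_pos fun j _ => hcard j)
  refine le_antisymm ?_ ?_
  · refine ENNReal.le_of_forall_pos_le_add fun ε hε _ => ?_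
    have hε' : (0 : ℝ) < ε := hε
    have hev : ∀ᶠ k : ℕ in atTop,
        (r ^ k) ^ (t + ε / 2) * ∏ j ∈ Finset.range k, ((D j).card : ℝ) ≤ 1 := by
      have h1 : t * -Real.log r < (t + ε / 2) * -Real.log r := by gcongr; linarith
      filter_upwards [ht.eventually_lt_const h1, eventually_gt_atTop 0] with k hk hk0
      rw [div_lt_iff₀ (by exact_mod_cast hk0)] at hk
      rw [← Real.log_nonpos_iff (hpos k _).le, hlog]
      linarith
    have h2 := (dimH_digitSet_eq_lowerBoxDim hA hr0 hr1 hr h𝒟 hne hD).trans_le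
      (lowerBoxDim_digitSet_le hr0 hr1 hr (h𝒟.finite hA) hD
        (by linarith : t + ε / 2 < t + ε) hev.frequently)
    have h3 : ((t + ε : ℝ) : EReal) ≤ ((ENNReal.ofReal t + ε : ℝ≥0∞) : EReal) := by
      rw [EReal.coe_ennreal_add, EReal.coe_ennreal_ofReal, EReal.coe_add]
      gcongr
      · exact_mod_cast le_max_left _ _
      · exact le_rfl
    exact EReal.coe_ennreal_le_coe_ennreal_iff.1 (h2.trans h3)
  · refine ENNReal.le_of_forall_nnreal_lt fun s hs => ?_
    have hst : (s : ℝ) < t := by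
      rw [← ENNReal.ofReal_coe_nnreal] at hs
      exact (ENNReal.ofReal_lt_ofReal_iff_of_nonneg s.2).1 hs
    refine le_dimH_digitSet hA hr0 hr1 hr h𝒟 hne hD ?_
    have h1 : (s : ℝ) * -Real.log r < t * -Real.log r := by gcongr
    filter_upwards [ht.eventually_const_lt h1, eventually_gt_atTop 0] with k hk hk0
    rw [lt_div_iff₀ (by exact_mod_cast hk0)] at hk
    rw [← Real.log_nonneg_iff (hpos k _), hlog]
    linarith

/-! ### The Moran structure -/

theorem exists_bijOn_Iio_card {α : Type*} [Inhabited α] (s : Finset α) :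
    ∃ g : ℕ → α, BijOn g (Iio s.card) s := by
  refine ⟨fun i => if h : i < s.card then s.equivFin.symm ⟨i, h⟩ else default, ?_, ?_, ?_⟩
  · intro i hi
    simp [dif_pos (mem_Iio.1 hi)]
  · intro i hi j hj hij
    simp only [dif_pos (mem_Iio.1 hi), dif_pos (mem_Iio.1 hj)] at hij
    simpa using s.equivFin.symm.injective (Subtype.ext hij)
  · intro x hx
    refine ⟨s.equivFin ⟨x, hx⟩, (s.equivFin ⟨x, hx⟩).2, ?_⟩
    simp

/-- The affine map `x ↦ ∑_{j ≤ k} A⁻ʲ d_j + A⁻ᵏ x` of a word `σ` of length `k`, whose `j`-th digit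
`d_j` is the one that `g` enumerates at the `j`-th letter. -/
def wordMap (A : Matrix (Fin n) (Fin n) ℤ) (g : ℕ → ℕ → Fin n → ℤ) (σ : List ℕ)
    (x : EuclideanSpace ℝ (Fin n)) : EuclideanSpace ℝ (Fin n) :=
  ∑ j ∈ Finset.range σ.length, (invMap A ^ (j + 1)) (toVec (g j (σ.getD j 0))) +
    (invMap A ^ σ.length) x

theorem wordMap_nil (A : Matrix (Fin n) (Fin n) ℤ) (g : ℕ → ℕ → Fin n → ℤ) :
    wordMap A g [] = id := by
  ext1 x; simp [wordMap]

theorem wordMap_append (A : Matrix (Fin n) (Fin n) ℤ) (g : ℕ → ℕ → Fin n → ℤ) (σ : List ℕ) (i : ℕ)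
    (x : EuclideanSpace ℝ (Fin n)) :
    wordMap A g (σ ++ [i]) x = wordMap A g σ (invMap A (x + toVec (g σ.length i))) := by
  have h1 : ∑ j ∈ Finset.range σ.length,
      (invMap A ^ (j + 1)) (toVec (g j ((σ ++ [i]).getD j 0))) =
      ∑ j ∈ Finset.range σ.length, (invMap A ^ (j + 1)) (toVec (g j (σ.getD j 0))) :=
    Finset.sum_congr rfl fun j hj => by
      rw [List.getD_append _ _ _ _ (Finset.mem_range.1 hj)]
  have h2 : (σ ++ [i]).getD σ.length 0 = i := by simp
  rw [wordMap, List.length_append, List.length_singleton, Finset.sum_range_succ, h1, h2, wordMap,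
    ← Module.End.mul_apply, ← pow_succ, map_add]
  abel

theorem dist_wordMap {A : Matrix (Fin n) (Fin n) ℤ} {r : ℝ} (hr : ∀ x, ‖invMap A x‖ = r * ‖x‖)
    (g : ℕ → ℕ → Fin n → ℤ) (σ : List ℕ) (x y : EuclideanSpace ℝ (Fin n)) :
    dist (wordMap A g σ x) (wordMap A g σ y) = r ^ σ.length * dist x y := by
  rw [wordMap, wordMap, dist_add_left, dist_eq_norm, ← map_sub, norm_pow_invMap hr, dist_eq_norm]

theorem diam_wordMap_image {A : Matrix (Fin n) (Fin n) ℤ} {r : ℝ} (hr0 : 0 < r)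
    (hr : ∀ x, ‖invMap A x‖ = r * ‖x‖) (g : ℕ → ℕ → Fin n → ℤ) (σ : List ℕ)
    (S : Set (EuclideanSpace ℝ (Fin n))) :
    Metric.diam (wordMap A g σ '' S) = r ^ σ.length * Metric.diam S := by
  have hpow : 0 < r ^ σ.length := by positivity
  have h : Metric.ediam (wordMap A g σ '' S) = ENNReal.ofReal (r ^ σ.length) * Metric.ediam S := by
    have hedist : ∀ x y, edist (wordMap A g σ x) (wordMap A g σ y) =
        ENNReal.ofReal (r ^ σ.length) * edist x y := fun x y => by
      rw [edist_dist, dist_wordMap hr, ENNReal.ofReal_mul hpow.le, ← edist_dist]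
    simp only [Metric.ediam, iSup_image, hedist, ENNReal.mul_iSup]
  rw [Metric.diam, h, ENNReal.toReal_mul, ENNReal.toReal_ofReal hpow.le, Metric.diam]

theorem volume_wordMap_image_eq_zero (A : Matrix (Fin n) (Fin n) ℤ) (g : ℕ → ℕ → Fin n → ℤ)
    (σ : List ℕ) {S : Set (EuclideanSpace ℝ (Fin n))} (hS : volume S = 0) :
    volume (wordMap A g σ '' S) = 0 := by
  have : wordMap A g σ '' S = (fun x => ∑ j ∈ Finset.range σ.length,
      (invMap A ^ (j + 1)) (toVec (g j (σ.getD j 0))) + x) '' ((invMap A ^ σ.length) '' S) := by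
    rw [image_image]; rfl
  rw [this, image_add_left, measure_preimage_add, Measure.addHaar_image_linearMap, hS, mul_zero]

theorem wordMap_expansion {A : Matrix (Fin n) (Fin n) ℤ} {r C : ℝ} (hr0 : 0 ≤ r) (hr1 : r < 1)
    (hr : ∀ x, ‖invMap A x‖ = r * ‖x‖) (g : ℕ → ℕ → Fin n → ℤ) {σ : List ℕ} {a : ℕ → Fin n → ℤ}
    (ha : ∀ j, ‖toVec (a j)‖ ≤ C) (hσ : ∀ j < σ.length, g j (σ.getD j 0) = a j) :
    wordMap A g σ (expansion A fun j => a (j + σ.length)) = expansion A a := by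
  rw [expansion_eq_sum_add hr0 hr1 hr ha σ.length, wordMap]
  congr 1
  exact Finset.sum_congr rfl fun j hj => by rw [hσ j (Finset.mem_range.1 hj)]

theorem invMap_add_mem_digitSet {A : Matrix (Fin n) (Fin n) ℤ} {r : ℝ} (hr0 : 0 ≤ r) (hr1 : r < 1)
    (hr : ∀ x, ‖invMap A x‖ = r * ‖x‖) {𝒟 : Set (Fin n → ℤ)} (h𝒟 : 𝒟.Finite)
    {x : EuclideanSpace ℝ (Fin n)} (hx : x ∈ digitSet A fun _ => 𝒟) {d : Fin n → ℤ} (hd : d ∈ 𝒟) :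
    invMap A (x + toVec d) ∈ digitSet A fun _ => 𝒟 := by
  obtain ⟨C, -, hC⟩ := exists_norm_toVec_le h𝒟
  obtain ⟨a, ha, rfl⟩ := hx
  let b : ℕ → Fin n → ℤ := fun j => Nat.casesOn j d a
  have hb : ∀ j, b j ∈ 𝒟 := fun j => by
    cases j with
    | zero => exact hd
    | succ j => exact ha j
  refine ⟨b, hb, ?_⟩
  rw [expansion_eq_sum_add hr0 hr1 hr (fun j => hC _ (hb j)) 1]
  simp only [Finset.sum_range_one, zero_add, pow_one, map_add]
  exact add_comm _ _

/-- The root is the full tile $T_{A,\mathcal D}$, because the digit set itself may have empty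
interior. All ratios are $r$, and the measure-zero overlaps of the tile make sibling interiors
disjoint. -/
theorem isMoranSet_digitSet (hn : 0 < n) {A : Matrix (Fin n) (Fin n) ℤ} {r : ℝ} (hr0 : 0 < r)
    (hr1 : r < 1) (hr : ∀ x, ‖invMap A x‖ = r * ‖x‖) {𝒟 : Set (Fin n → ℤ)} (h𝒟 : 𝒟.Finite)
    (htile : IsSelfAffineTile A 𝒟) {D : ℕ → Finset (Fin n → ℤ)} (hne : ∀ j, (D j).Nonempty)
    (hD : ∀ j, ↑(D j) ⊆ 𝒟) : IsMoranSet (digitSet A fun j => (D j : Set (Fin n → ℤ))) := by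
  obtain ⟨C, hC0, hC⟩ := exists_norm_toVec_le h𝒟
  obtain ⟨htile, hvol⟩ := htile
  rw [selfAffineSet_eq_digitSet hr0.le hr1 hr h𝒟] at htile hvol
  set T := digitSet A fun _ => 𝒟 with hT
  choose b hb using hne
  choose g hg using fun j => exists_bijOn_Iio_card (D j)
  have hgD : ∀ j, ∀ i < (D j).card, g j i ∈ D j := fun j i hi => (hg j).mapsTo hi
  have hTcpt : IsCompact T := isCompact_digitSet hr0.le hr1 hr h𝒟 fun _ => le_rfl
  have hTint : (interior T).Nonempty := by
    rw [← closure_nonempty_iff, ← htile]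
    exact ⟨_, b, fun j => hD j (hb j), rfl⟩
  -- This uses $n>0$: for $n=0$ the tile is a point, and the quotients of diameters would be $0/0$.
  have hdiam : 0 < Metric.diam T := by
    have : Nonempty (Fin n) := ⟨⟨0, hn⟩⟩
    obtain ⟨x, hx⟩ := hTint
    have hnt : T.Nontrivial :=
      (infinite_of_mem_nhds x (mem_interior_iff_mem_nhds.1 hx)).nontrivial
    exact Metric.diam_pos hnt hTcpt.isBounded
  have hletter : ∀ k, ∀ σ ∈ words (fun j => (D j).card) k, ∀ j < k,
      g j (σ.getD j 0) ∈ D j := by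
    rintro _ σ ⟨rfl, hσ⟩ j hj
    rw [List.getD_eq_getElem _ _ hj]
    exact hgD j _ (hσ j hj)
  refine ⟨fun j => (D j).card, fun _ _ => r, T, fun σ => wordMap A g σ '' T, ?_, ?_⟩
  · refine ⟨fun k => Finset.card_pos.2 ⟨_, hb k⟩, fun _ _ _ => ⟨hr0, hr1⟩, hTcpt, hTint, ?_, ?_, ?_,
      ?_, ?_⟩
    · rw [wordMap_nil, image_id]
    · rintro k σ ⟨hlen, -⟩
      refine ⟨wordMap A g σ, ⟨r ^ (k + 1), by positivity, pow_lt_one₀ hr0.le hr1 k.succ_ne_zero,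
        fun x y => ?_⟩, rfl⟩
      rw [dist_wordMap hr, hlen]
    · rintro k σ ⟨hlen, -⟩ j hj
      rintro _ ⟨x, hx, rfl⟩
      refine ⟨_, invMap_add_mem_digitSet hr0.le hr1 hr h𝒟 hx (hD k (hgD k j hj)), ?_⟩
      rw [wordMap_append, hlen]
    · rintro k σ ⟨hlen, -⟩ j hj
      rw [diam_wordMap_image hr0 hr, diam_wordMap_image hr0 hr, List.length_append,
        List.length_singleton, pow_succ]
      field_simp
    · rintro k σ ⟨hlen, -⟩ j hj l hl hjl
      have himage : ∀ i, wordMap A g (σ ++ [i]) '' T =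
          wordMap A g σ '' (invMap A '' translate T (toVec (g k i))) := fun i => by
        rw [translate, image_image, image_image]
        exact image_congr fun x _ => by rw [wordMap_append, hlen]
      have hinj : Function.Injective (wordMap A g σ) := fun x y hxy => by
        have := dist_wordMap hr g σ x y
        rw [hxy, dist_self, zero_eq_mul] at this
        exact dist_eq_zero.1 (this.resolve_left (by positivity))
      have hinj' : Function.Injective (invMap A) := (injective_iff_map_eq_zero _).2 fun x hx => by
        have := hr x
        rw [hx, norm_zero, zero_eq_mul] at this
        exact norm_eq_zero.1 (this.resolve_left hr0.ne')
      -- The siblings are images of $T+d$ and $T+d'$ under the same injective affine map, so their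
      -- intersection is null; an open null set is empty.
      have hzero : volume (wordMap A g (σ ++ [j]) '' T ∩ wordMap A g (σ ++ [l]) '' T) = 0 := by
        rw [himage, himage, ← image_inter hinj, ← image_inter hinj']
        refine volume_wordMap_image_eq_zero A g σ ?_
        rw [Measure.addHaar_image_linearMap, hvol _ (hD k (hgD k j hj)) _ (hD k (hgD k l hl))
          fun h => hjl ((hg k).injOn hj hl h), mul_zero]
      rw [disjoint_iff_inter_eq_empty, ← interior_inter]
      exact isOpen_interior.eq_empty_of_measure_zero (measure_mono_null interior_subset hzero)
  · refine Subset.antisymm ?_ ?_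
    · rintro _ ⟨a, ha, rfl⟩
      choose i hi hia using fun j => (hg j).surjOn (ha j)
      refine mem_iInter.2 fun k => ?_
      set σ : List ℕ := List.ofFn fun j : Fin (k + 1) => i j with hσ
      have hlen : σ.length = k + 1 := by simp [hσ]
      have hget : ∀ j (hj : j < σ.length), σ[j] = i j := fun j hj => by
        simp only [hσ, List.getElem_ofFn]
      refine mem_iUnion₂.2 ⟨σ, ⟨hlen, fun j hj => ?_⟩, _, ?_,
        wordMap_expansion hr0.le hr1 hr g (fun j => hC _ (hD j (ha j))) fun j hj => ?_⟩
      · rw [hget]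
        exact hi j
      · exact ⟨_, fun j => hD _ (ha _), rfl⟩
      · rw [List.getD_eq_getElem _ _ hj, hget, hia]
    -- The tail of a point of $J_\sigma$ may use any digits of $\mathcal D$. Replacing it by the
    -- admissible tail `b` moves the point by at most $r^{k+1}R$, so $x$ lies in the closure of the
    -- digit set, which is closed.
    · intro x hx
      have hclosed := (isCompact_digitSet hr0.le hr1 hr h𝒟 hD).isClosed
      rw [← hclosed.closure_eq, Metric.mem_closure_iff]
      intro ε hε
      set R : ℝ := 2 * (r * C / (1 - r)) with hR
      have hlim : Tendsto (fun k : ℕ => r ^ (k + 1) * R) atTop (𝓝 0) := by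
        simpa using ((tendsto_pow_atTop_nhds_zero_of_lt_one hr0.le hr1).comp
          (tendsto_add_atTop_nat 1)).mul_const R
      obtain ⟨k, hk⟩ := (hlim.eventually_lt_const hε).exists
      obtain ⟨σ, hσ, y, ⟨a, ha, rfl⟩, rfl⟩ := mem_iUnion₂.1 (mem_iInter.1 hx k)
      let e : ℕ → Fin n → ℤ := fun j => if j < k + 1 then g j (σ.getD j 0) else b j
      have he : ∀ j, e j ∈ D j := fun j => by
        by_cases hj : j < k + 1
        · simpa only [e, if_pos hj] using hletter _ σ hσ j hj
        · simpa only [e, if_neg hj] using hb j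
      refine ⟨expansion A e, ⟨e, he, rfl⟩, lt_of_le_of_lt ?_ hk⟩
      rw [← wordMap_expansion hr0.le hr1 hr g (σ := σ) (fun j => hC _ (hD j (he j)))
        fun j hj => (if_pos (hσ.1 ▸ hj)).symm, dist_wordMap hr, hσ.1]
      gcongr
      rw [hR, two_mul]
      exact (dist_le_norm_add_norm _ _).trans (add_le_add
        (norm_expansion_le hr0.le hr1 hr fun j => hC _ (ha j))
        (norm_expansion_le hr0.le hr1 hr fun j => hC _ (hD _ (he _))))

/-! ### Overlaps $D\cap(D+v)$ and the sets $T(\alpha)$ -/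

/-- The elements `d` of `D` with `d - v ∈ D`, that is, `D ∩ (D + v)`. -/
def overlap (D : Finset (Fin n → ℤ)) (v : Fin n → ℤ) : Finset (Fin n → ℤ) :=
  D.filter fun d => d - v ∈ D

theorem mem_overlap {D : Finset (Fin n → ℤ)} {v d : Fin n → ℤ} :
    d ∈ overlap D v ↔ d ∈ D ∧ d - v ∈ D := by
  simp [overlap]

theorem overlap_zero (D : Finset (Fin n → ℤ)) : overlap D 0 = D := by
  ext; simp [mem_overlap]

theorem overlap_subset (D : Finset (Fin n → ℤ)) (v : Fin n → ℤ) : overlap D v ⊆ D :=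
  Finset.filter_subset _ _

theorem overlap_nonempty_iff {D : Finset (Fin n → ℤ)} {v : Fin n → ℤ} :
    (overlap D v).Nonempty ↔ v ∈ (D : Set (Fin n → ℤ)) - D := by
  rw [Set.mem_sub]
  constructor
  · rintro ⟨d, hd⟩
    exact ⟨d, (mem_overlap.1 hd).1, d - v, (mem_overlap.1 hd).2, by abel⟩
  · rintro ⟨d, hd, e, he, rfl⟩
    exact ⟨d, mem_overlap.2 ⟨hd, by simpa using he⟩⟩

/-- The difference of the lexicographic maximum and minimum of $D$ is attained by that pair alone,
as the order is translation invariant. -/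
theorem exists_overlap_card_eq_one {D : Finset (Fin n → ℤ)} (hD : D.Nonempty) :
    ∃ v, (overlap D v).card = 1 := by
  obtain ⟨d, hd, hmax⟩ := D.exists_max_image toLex hD
  obtain ⟨e, he, hmin⟩ := D.exists_min_image toLex hD
  refine ⟨d - e, Finset.card_eq_one.2 ⟨d, ?_⟩⟩
  ext x
  rw [mem_overlap, Finset.mem_singleton]
  constructor
  · rintro ⟨hx, hx'⟩
    refine toLex.injective (le_antisymm (hmax x hx) ?_)
    have h : toLex (e + (d - e)) ≤ toLex (x - (d - e) + (d - e)) :=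
      add_le_add_left (hmin _ hx') (toLex (d - e))
    simpa using h
  · rintro rfl
    exact ⟨hd, by simpa using he⟩

theorem expansion_sub {A : Matrix (Fin n) (Fin n) ℤ} {r : ℝ} (hr0 : 0 ≤ r) (hr1 : r < 1)
    (hr : ∀ x, ‖invMap A x‖ = r * ‖x‖) {D E : Set (Fin n → ℤ)} (hD : D.Finite) (hE : E.Finite)
    {a b : ℕ → Fin n → ℤ} (ha : ∀ j, a j ∈ D) (hb : ∀ j, b j ∈ E) :
    expansion A (a - b) = expansion A a - expansion A b := by
  obtain ⟨C, -, hC⟩ := exists_norm_toVec_le hD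
  obtain ⟨C', -, hC'⟩ := exists_norm_toVec_le hE
  rw [expansion, expansion, expansion,
    ← (summable_expansion hr0 hr1 hr fun j => hC _ (ha j)).tsum_sub
      (summable_expansion hr0 hr1 hr fun j => hC' _ (hb j))]
  refine tsum_congr fun j => ?_
  rw [Pi.sub_apply, toVec_sub, map_sub]

theorem mem_nonemptyTranslations_iff {A : Matrix (Fin n) (Fin n) ℤ} {r : ℝ} (hr0 : 0 ≤ r)
    (hr1 : r < 1) (hr : ∀ x, ‖invMap A x‖ = r * ‖x‖) {D : Finset (Fin n → ℤ)}
    {α : EuclideanSpace ℝ (Fin n)} :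
    α ∈ nonemptyTranslations A D ↔
      ∃ a : ℕ → Fin n → ℤ, (∀ j, a j ∈ (D : Set (Fin n → ℤ)) - D) ∧ expansion A a = α := by
  simp only [nonemptyTranslations, inter, translate,
    selfAffineSet_eq_digitSet hr0 hr1 hr D.finite_toSet]
  constructor
  · rintro ⟨_, ⟨d, hd, rfl⟩, _, ⟨e, he, rfl⟩, h⟩
    refine ⟨d - e, fun j => Set.sub_mem_sub (hd j) (he j), ?_⟩
    rw [expansion_sub hr0 hr1 hr D.finite_toSet D.finite_toSet hd he]
    exact sub_eq_of_eq_add' h.symm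
  · rintro ⟨a, ha, rfl⟩
    choose d hd e he hde using fun j => Set.mem_sub.1 (ha j)
    obtain rfl : d - e = a := funext hde
    refine ⟨_, ⟨d, hd, rfl⟩, _, ⟨e, he, rfl⟩, ?_⟩
    rw [expansion_sub hr0 hr1 hr D.finite_toSet D.finite_toSet hd he]
    exact add_sub_cancel _ _

/-- A point of the intersection has digits $d$ and its translate back by $\alpha$ has digits $e$;
then $d-e$ and $a$ both represent $\alpha$, so they agree digit by digit. -/
theorem inter_eq_digitSet {A : Matrix (Fin n) (Fin n) ℤ} {r : ℝ} (hr0 : 0 ≤ r)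
    (hr1 : r < 1) (hr : ∀ x, ‖invMap A x‖ = r * ‖x‖) {D : Finset (Fin n → ℤ)}
    (huniq : UniqueRepresentations A (D - D : Set (Fin n → ℤ))) {a : ℕ → Fin n → ℤ}
    (ha : ∀ j, a j ∈ (D : Set (Fin n → ℤ)) - D) :
    inter A D (expansion A a) = digitSet A fun j => (overlap D (a j) : Set (Fin n → ℤ)) := by
  have hfin : ((D : Set (Fin n → ℤ)) - D).Finite := D.finite_toSet.sub D.finite_toSet
  rw [inter, translate, selfAffineSet_eq_digitSet hr0 hr1 hr D.finite_toSet]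
  ext x
  constructor
  · rintro ⟨⟨d, hd, rfl⟩, _, ⟨e, he, rfl⟩, h⟩
    have hsub := expansion_sub hr0 hr1 hr D.finite_toSet D.finite_toSet hd he
    have hda : d - e = a := huniq (expansion A a) _ _
      ((isRepresentation_iff hr0 hr1 hr hfin).2 ⟨fun j => Set.sub_mem_sub (hd j) (he j),
        hsub.trans (sub_eq_of_eq_add' h.symm)⟩)
      ((isRepresentation_iff hr0 hr1 hr hfin).2 ⟨ha, rfl⟩)
    refine ⟨d, fun j => mem_overlap.2 ⟨hd j, ?_⟩, rfl⟩
    rw [← hda]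
    simpa using he j
  · rintro ⟨d, hd, rfl⟩
    have hd1 : ∀ j, d j ∈ (D : Set (Fin n → ℤ)) := fun j => (mem_overlap.1 (hd j)).1
    refine ⟨⟨d, hd1, rfl⟩, expansion A (d - a),
      ⟨d - a, fun j => (mem_overlap.1 (hd j)).2, rfl⟩, ?_⟩
    rw [expansion_sub hr0 hr1 hr D.finite_toSet hfin hd1 ha]
    exact sub_add_cancel _ _

/-! ### Density of the level sets -/

theorem tendsto_sum_div_of_eventually_eq {u v : ℕ → ℝ} {l : ℝ} {K : ℕ} (huv : ∀ j ≥ K, u j = v j)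
    (hv : Tendsto (fun k : ℕ => (∑ j ∈ Finset.range k, v j) / k) atTop (𝓝 l)) :
    Tendsto (fun k : ℕ => (∑ j ∈ Finset.range k, u j) / k) atTop (𝓝 l) := by
  have h := hv.add (tendsto_const_div_atTop_nhds_zero_nat
    ((∑ j ∈ Finset.range K, u j) - ∑ j ∈ Finset.range K, v j))
  rw [add_zero] at h
  refine h.congr' ?_
  filter_upwards [eventually_ge_atTop K] with k hk
  rw [← add_div, ← Finset.sum_range_add_sum_Ico u hk, ← Finset.sum_range_add_sum_Ico v hk,
    Finset.sum_congr rfl fun j hj => huv j (Finset.mem_Ico.1 hj).1]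
  ring

/-- The `j`-th term, `0` or `1`, of a sequence in which the ones have density `θ`. -/
def floorStep (θ : ℝ) (j : ℕ) : ℝ := (⌊θ * (j + 1 : ℕ)⌋₊ : ℝ) - ⌊θ * j⌋₊

theorem floorStep_eq_zero_or_one {θ : ℝ} (h0 : 0 ≤ θ) (h1 : θ ≤ 1) (j : ℕ) :
    floorStep θ j = 0 ∨ floorStep θ j = 1 := by
  have hle : ⌊θ * j⌋₊ ≤ ⌊θ * (j + 1 : ℕ)⌋₊ := Nat.floor_mono (by gcongr; simp)
  have hle' : ⌊θ * (j + 1 : ℕ)⌋₊ ≤ ⌊θ * j⌋₊ + 1 := by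
    rw [← Nat.floor_add_one (by positivity)]
    refine Nat.floor_mono ?_
    push_cast
    linarith
  rw [floorStep]
  rcases Nat.le_add_one_iff.1 hle' with h | h
  · left
    rw [le_antisymm h hle, sub_self]
  · right
    rw [h]
    simp

/-- The sum telescopes to $\lfloor\theta k\rfloor$. -/
theorem tendsto_sum_floorStep_div {θ : ℝ} (h0 : 0 ≤ θ) :
    Tendsto (fun k : ℕ => (∑ j ∈ Finset.range k, floorStep θ j) / k) atTop (𝓝 θ) := by
  refine ((tendsto_nat_floor_mul_div_atTop h0).comp tendsto_natCast_atTop_atTop).congr fun k => ?_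
  simp only [floorStep]
  rw [Finset.sum_range_sub fun j : ℕ => (⌊θ * j⌋₊ : ℝ)]
  simp

theorem dimH_selfAffineSet {A : Matrix (Fin n) (Fin n) ℤ} (hA : A.det ≠ 0) {r : ℝ}
    (hr0 : 0 < r) (hr1 : r < 1) (hr : ∀ x, ‖invMap A x‖ = r * ‖x‖) {𝒟 : Set (Fin n → ℤ)}
    (h𝒟 : IsCompleteResidueSystem A 𝒟) {D : Finset (Fin n → ℤ)} (hne : D.Nonempty)
    (hD : ↑D ⊆ 𝒟) :
    dimH (selfAffineSet A D) = ENNReal.ofReal (Real.log D.card / -Real.log r) := by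
  have hl : 0 < -Real.log r := neg_pos.2 (Real.log_neg hr0 hr1)
  rw [selfAffineSet_eq_digitSet hr0.le hr1 hr D.finite_toSet]
  refine dimH_digitSet_of_tendsto hA hr0 hr1 hr h𝒟 (D := fun _ => D) (fun _ => hne) (fun _ => hD) ?_
  rw [div_mul_cancel₀ _ hl.ne']
  refine tendsto_const_nhds.congr' ?_
  filter_upwards [eventually_gt_atTop 0] with k hk
  have : (k : ℝ) ≠ 0 := by exact_mod_cast hk.ne'
  rw [Finset.sum_const, Finset.card_range, nsmul_eq_mul]
  field_simp

theorem dense_preimage_Psi {A : Matrix (Fin n) (Fin n) ℤ} (hA : A.det ≠ 0) {r : ℝ}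
    (hr0 : 0 < r) (hr1 : r < 1) (hr : ∀ x, ‖invMap A x‖ = r * ‖x‖) {𝒟 : Set (Fin n → ℤ)}
    (h𝒟 : IsCompleteResidueSystem A 𝒟) {D : Finset (Fin n → ℤ)} (hD : ↑D ⊆ 𝒟)
    (huniq : UniqueRepresentations A (D - D : Set (Fin n → ℤ)))
    (s : Icc (0 : ℝ≥0∞) (dimH (selfAffineSet A D))) : Dense (Psi A D ⁻¹' {s}) := by
  rw [Metric.dense_iff]
  rintro ⟨α, hα⟩ ε hε
  obtain ⟨a, ha, rfl⟩ := (mem_nonemptyTranslations_iff hr0.le hr1 hr).1 hα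
  have hne : D.Nonempty := (overlap_nonempty_iff.2 (ha 0)).mono (overlap_subset _ _)
  have hl : 0 < -Real.log r := neg_pos.2 (Real.log_neg hr0 hr1)
  have hm : 0 ≤ Real.log D.card := Real.log_natCast_nonneg _
  have hs := s.2.2.trans_eq (dimH_selfAffineSet hA hr0 hr1 hr h𝒟 hne hD)
  have hs_ne : (s : ℝ≥0∞) ≠ ⊤ := ne_top_of_le_ne_top ENNReal.ofReal_ne_top hs
  set q : ℝ := (s : ℝ≥0∞).toReal with hq
  have hq0 : 0 ≤ q := ENNReal.toReal_nonneg
  have hqm : q * -Real.log r ≤ Real.log D.card := by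
    rw [← le_div_iff₀ hl]
    exact ENNReal.toReal_le_of_le_ofReal (by positivity) hs
  -- The density $\theta$ is $q$ divided by $\dim_H T_{A,D}$. If $|D|=1$ that dimension vanishes, so
  -- $q=0$ and $\theta=0$ serves.
  obtain ⟨θ, hθ0, hθ1, hθ⟩ : ∃ θ : ℝ, 0 ≤ θ ∧ θ ≤ 1 ∧ θ * Real.log D.card = q * -Real.log r := by
    rcases hm.eq_or_lt with h0 | h0
    · refine ⟨0, le_rfl, zero_le_one, ?_⟩
      rw [zero_mul]
      exact le_antisymm (by positivity) (hqm.trans h0.ge)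
    · exact ⟨q * -Real.log r / Real.log D.card, by positivity, (div_le_one h0).2 hqm,
        div_mul_cancel₀ _ h0.ne'⟩
  obtain ⟨v, hv⟩ := exists_overlap_card_eq_one hne
  have hvD : v ∈ (D : Set (Fin n → ℤ)) - D :=
    overlap_nonempty_iff.1 (Finset.card_pos.1 (hv ▸ one_pos))
  have h0D : 0 ∈ (D : Set (Fin n → ℤ)) - D :=
    overlap_nonempty_iff.1 ((overlap_zero D).symm ▸ hne)
  obtain ⟨C, hC0, hC⟩ := exists_norm_toVec_le (D.finite_toSet.sub D.finite_toSet)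
  have hlim : Tendsto (fun k : ℕ => r ^ k * (2 * (r * C / (1 - r)))) atTop (𝓝 0) := by
    simpa using (tendsto_pow_atTop_nhds_zero_of_lt_one hr0.le hr1).mul_const
      (2 * (r * C / (1 - r)))
  obtain ⟨K, hK⟩ := (hlim.eventually_lt_const hε).exists
  -- The first $K$ digits of $a$ keep the point within $\varepsilon$. Afterwards the digit $0$
  -- contributes $\log|D|$ and $v$ contributes $\log 1=0$, so the average tends to
  -- $\theta\log|D|=q(-\log r)$.
  let b : ℕ → Fin n → ℤ := fun j => if j < K then a j else if floorStep θ j = 1 then 0 else v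
  have hb : ∀ j, b j ∈ (D : Set (Fin n → ℤ)) - D := fun j => by
    simp only [b]
    split_ifs
    exacts [ha j, h0D, hvD]
  refine ⟨⟨expansion A b, (mem_nonemptyTranslations_iff hr0.le hr1 hr).2 ⟨b, hb, rfl⟩⟩, ?_, ?_⟩
  · rw [Metric.mem_ball, Subtype.dist_eq]
    exact (dist_expansion_le hr0.le hr1 hr (fun j => hC _ (hb j)) (fun j => hC _ (ha j))
      fun j hj => if_pos hj).trans_lt hK
  · refine Subtype.ext ?_
    change dimH (inter A D (expansion A b)) = s
    rw [inter_eq_digitSet hr0.le hr1 hr huniq hb, ← ENNReal.ofReal_toReal hs_ne]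
    refine dimH_digitSet_of_tendsto hA hr0 hr1 hr h𝒟 (D := fun j => overlap D (b j))
      (fun j => overlap_nonempty_iff.2 (hb j))
      (fun j => (Finset.coe_subset.2 (overlap_subset _ _)).trans hD) ?_
    refine tendsto_sum_div_of_eventually_eq (K := K)
      (v := fun j => floorStep θ j * Real.log D.card) (fun j hj => ?_) ?_
    · simp only [b, if_neg hj.not_gt]
      rcases floorStep_eq_zero_or_one hθ0 hθ1 j with h | h
      · rw [h, if_neg zero_ne_one, hv]
        simp
      · rw [h, if_pos rfl, overlap_zero, one_mul]
    · rw [← hq, ← hθ]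
      refine ((tendsto_sum_floorStep_div hθ0).mul_const (Real.log D.card)).congr fun k => ?_
      rw [← Finset.sum_mul]
      ring

end RadixTile

end

theorem mainTheorem4 {n : ℕ} (hn : 0 < n)
    (A : Matrix (Fin n) (Fin n) ℤ) (hA : A.det ≠ 0)
    (hsim : RadixTile.IsSimilarity (RadixTile.invMap A))
    (𝒟 : Set (Fin n → ℤ)) (hres : RadixTile.IsCompleteResidueSystem A 𝒟)
    (htile : RadixTile.IsSelfAffineTile A 𝒟)
    (D : Set (Fin n → ℤ)) (hD : D ⊆ 𝒟)
    (huniq : RadixTile.UniqueRepresentations A (D - D)) :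
    (∀ s : Set.Icc (0 : ℝ≥0∞) (dimH (RadixTile.selfAffineSet A D)),
      Dense (RadixTile.Psi A D ⁻¹' {s})) ∧
    ∀ α ∈ RadixTile.nonemptyTranslations A D,
      RadixTile.IsMoranSet (RadixTile.inter A D α) ∧
      ((dimH (RadixTile.inter A D α) : ℝ≥0∞) : EReal) =
        RadixTile.lowerBoxDim (RadixTile.inter A D α) := by
  obtain ⟨r, hr0, hr1, hdist⟩ := hsim
  have hr : ∀ x, ‖RadixTile.invMap A x‖ = r * ‖x‖ := fun x => by
    simpa using hdist x 0
  lift D to Finset (Fin n → ℤ) using (hres.finite hA).subset hD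
  refine ⟨RadixTile.dense_preimage_Psi hA hr0 hr1 hr hres hD huniq, fun α hα => ?_⟩
  obtain ⟨a, ha, rfl⟩ := (RadixTile.mem_nonemptyTranslations_iff hr0.le hr1 hr).1 hα
  have hne : ∀ j, (RadixTile.overlap D (a j)).Nonempty := fun j =>
    RadixTile.overlap_nonempty_iff.2 (ha j)
  have hsub : ∀ j, (RadixTile.overlap D (a j) : Set (Fin n → ℤ)) ⊆ 𝒟 := fun j =>
    (Finset.coe_subset.2 (RadixTile.overlap_subset _ _)).trans hD
  rw [RadixTile.inter_eq_digitSet hr0.le hr1 hr huniq ha]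
  exact ⟨RadixTile.isMoranSet_digitSet hn hr0 hr1 hr (hres.finite hA) htile hne hsub,
    RadixTile.dimH_digitSet_eq_lowerBoxDim hA hr0 hr1 hr hres hne hsub⟩
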